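/- Let $L$ be an even positive integer, $M$ a positive integer, $\beta = L^2$, $N = LM$, and let $\mathbb F$ be a field of characteristic $0$ (for instance $\mathbb R$ or $\mathbb C$). Let $V=\mathbb F^N$ with basis $\mathbf e_0,\dots,\mathbf e_{N-1}$. For an $L$-element subset $\mathfrak t=\{\mathfrak t(0)<\dots<\mathfrak t(L-1)\}$ of $\{0,1,\dots,N-1\}$ put $\mathbf e_{\mathfrak t}=\mathbf e_{\mathfrak t(0)}\wedge\dots\wedge\mathbf e_{\mathfrak t(L-1)}$, $$\Sigma\mathfrak t=\sum_{k=0}^{L-1}\mathfrak t(k),\qquad \overline\Sigma=\frac{L(N-1)}2,\qquad \widetilde\Delta\mathfrak t=\prod_{0\le j<k\le L-1}\frac{\mathfrak t(k)-\mathfrak t(j)}{k-j}.$$ For $\omega\in\Lambda^L V$ let the hyperpfaffian $\mathrm{PF}(\omega)$ be the coefficient of $\mathbf e_0\wedge\dots\wedge\mathbf e_{N-1}$ in $\omega^{\wedge M}/M!\in\Lambda^N V$. Then $$\mathrm{PF}\Big(\sum_{\mathfrak t\,:\,\Sigma\mathfrak t=\overline\Sigma}\widetilde\Delta\mathfrak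 t\;\mathbf e_{\mathfrak t}\Big)=\frac1{M!}\binom{\beta M/2}{\beta/2,\dots,\beta/2}=\frac{1}{M!}\,\frac{(\beta M/2)!}{\big((\beta/2)!\big)^M},$$ the sum being over all $L$-element subsets $\mathfrak t$ of $\{0,\dots,N-1\}$ with $\Sigma\mathfrak t=\overline\Sigma$. Moreover, for $\mathbb F=\mathbb C$ this hyperpfaffian is the partition function of the circular $\beta$-ensemble of $M$ particles: with $\mu$ the Haar probability measure on the unit circle $\mathbb T\subset\mathbb C$, $$Z:=\frac1{M!}\int_{\mathbb T^M}\prod_{1\le m<n\le M}|x_n-x_m|^{\beta}\,d\mu^M(\mathbf x)=\mathrm{PF}\Big(\sum_{\mathfrak t\,:\,\Sigma\mathfrak t=\overline\Sigma}\widetilde\Delta\mathfrak t\;\mathbf e_{\mathfrak t}\Big).$$ -/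

import Mathlib

open MeasureTheory
open scoped Nat

noncomputable section

namespace Hyperpfaffian

/-- The vector space `V = span {e_0, …, e_{N-1}}` over `𝕜`, with its preferred basis. -/
abbrev stdBasis (𝕜 : Type*) [Field 𝕜] (N : ℕ) : Module.Basis (Fin N) 𝕜 (Fin N → 𝕜) :=
  Pi.basisFun 𝕜 (Fin N)

/-- The Hodge star on the determinantal line `Λ^N V`, `N = dim V`: the coefficient of the volume
form `e_0 ∧ ⋯ ∧ e_{N-1}`. (It is defined on the whole exterior algebra, and is only applied to
elements of `Λ^N V`.) -/
def starTop {𝕜 : Type*} [Field 𝕜] {N : ℕ} (α : ExteriorAlgebra 𝕜 (Fin N → 𝕜)) : 𝕜 :=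
  (stdBasis 𝕜 N).ExteriorAlgebra.repr α Finset.univ

/-- The hyperpfaffian `PF ω = ∗ (ω ^ M / M!)` of an `L`-vector `ω` over the space `V` of
dimension `N = L M`; products and powers are those of the exterior algebra. -/
def PF {𝕜 : Type*} [Field 𝕜] {L M : ℕ} (ω : ⋀[𝕜]^L (Fin (L * M) → 𝕜)) : 𝕜 :=
  starTop ((M ! : 𝕜)⁻¹ • (ω : ExteriorAlgebra 𝕜 (Fin (L * M) → 𝕜)) ^ M)

/-- The increasing enumeration `t(0) < ⋯ < t(L-1)` of an `L`-element subset `t` of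
`{0, …, N-1}`, with values in `ℕ`. -/
def elt {N L : ℕ} (t : Set.powersetCard (Fin N) L) (k : Fin L) : ℕ :=
  (Set.powersetCard.ofFinEmbEquiv.symm t k : Fin N)

/-- `Σ t`, the sum of the elements of `t`. -/
def sigma {N L : ℕ} (t : Set.powersetCard (Fin N) L) : ℕ :=
  ∑ k : Fin L, elt t k

/-- `Σ̄ = L (N - 1) / 2`, as a rational number. -/
def sigmaBar (N L : ℕ) : ℚ :=
  (L : ℚ) * ((N : ℚ) - 1) / 2

/-- `Δ̃ t = ∏_{j < k} (t(k) - t(j)) / (k - j)`. -/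
def deltaTilde (𝕜 : Type*) [Field 𝕜] {N L : ℕ} (t : Set.powersetCard (Fin N) L) : 𝕜 :=
  ∏ j : Fin L, ∏ k ∈ Finset.Ioi j,
    ((elt t k : 𝕜) - (elt t j : 𝕜)) / (((k : ℕ) : 𝕜) - ((j : ℕ) : 𝕜))

/-- The `L`-vector `∑_{Σ t = Σ̄} Δ̃ t e_t`, the sum being over the `L`-element subsets `t` of
`{0, …, N-1}`, `N = L M`, with `Σ t = Σ̄`. -/
def circularGram (𝕜 : Type*) [Field 𝕜] (L M : ℕ) : ⋀[𝕜]^L (Fin (L * M) → 𝕜) :=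
  ∑ t : Set.powersetCard (Fin (L * M)) L with (sigma t : ℚ) = sigmaBar (L * M) L,
    deltaTilde 𝕜 t • (stdBasis 𝕜 (L * M)).exteriorPower L t

/-- The unit circle `𝕋` carries its Borel `σ`-algebra. -/
instance : MeasurableSpace Circle := borel Circle

instance : BorelSpace Circle := ⟨rfl⟩

/-- Haar probability measure on the unit circle. -/
def circleHaar : Measure Circle :=
  Measure.haarMeasure ⊤

instance : IsProbabilityMeasure circleHaar :=
  ⟨Measure.haarMeasure_self⟩

/-- The partition function
`Z = (1 / M!) ∫_{𝕋^M} ∏_{m < n} |x_n - x_m| ^ β dμ(x_1) ⋯ dμ(x_M)` of the circular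
`β`-ensemble of `M` particles (weight `1`). -/
def circularPartitionFunction (β M : ℕ) : ℝ :=
  (M ! : ℝ)⁻¹ * ∫ x : Fin M → Circle,
    ∏ m : Fin M, ∏ n ∈ Finset.Ioi m, ‖(x n : ℂ) - (x m : ℂ)‖ ^ β
      ∂(Measure.pi fun _ : Fin M => circleHaar)

end Hyperpfaffian

end

namespace Hyperpfaffian

open Finset Matrix Polynomial

/-! ### Binomial and confluent Vandermonde determinants. -/

section Determinants

variable {R : Type*} [CommRing R]

/-! Let `ω(x)` be the wedge over `k < L` of the vectors `∑ n, (n choose k) x^n e_n`. Its coordinate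
at `t` is a binomial minor, equal to `x^(Σ t) Δ̃ t` (`ιMulti_choose_mul_pow`). The top coefficient
of `ω(x_0) ∧ ⋯ ∧ ω(x_{M-1})` is a confluent Vandermonde determinant: `∏ x_m^(L(L-1)/2)` times
`∏_{l<m} (x_m - x_l)^(L^2)`.

The coefficient of `∏ x_m^Σ̄` on the expanded side keeps exactly the tuples with every `Σ t_m = Σ̄`,
which is the `M`-th power of the given `L`-vector; on the other side it is the central coefficient
of `∏ (X_n - X_m)^β` (`PF_circularGram`). Dyson's identity, proved by Good's recursion, evaluates it
as a multinomial (`coeff_dysonPoly`). Averaging over the torus extracts the same coefficient, which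
gives the partition function. -/

theorem det_vandermonde_natCast_eq_mul_det_choose [IsDomain R] {n : ℕ} (v : Fin n → ℕ) :
    (vandermonde fun i => (v i : R)).det =
      (∏ j : Fin n, ((j : ℕ)! : R)) * (of fun i j : Fin n => ((v i).choose j : R)).det := by
  rw [det_eval_matrixOfPolynomials_eq_det_vandermonde _ (fun j : Fin n => descPochhammer R j)
    (fun j => descPochhammer_natDegree R j) (fun j => monic_descPochhammer R j), ← det_mul_row]
  congr 1
  ext i j
  simp only [of_apply]
  rw [descPochhammer_eval_eq_descFactorial, Nat.descFactorial_eq_factorial_mul_choose,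
    Nat.cast_mul]

theorem det_choose_self (n : ℕ) :
    (of fun i j : Fin n => ((i : ℕ).choose j : R)).det = 1 := by
  rw [det_of_isLowerTriangular]
  · simp
  · intro i j hij
    have : (i : ℕ) < j := hij
    simp [Nat.choose_eq_zero_of_lt this]

/-- Falling factorials are monic, so a Vandermonde determinant is `∏ j!` times a binomial one.
Dividing by the case of the nodes `0, …, n-1`, where the binomial matrix is unitriangular, cancels
the factorials. -/
theorem det_choose_eq_prod_div {𝕜 : Type*} [Field 𝕜] [CharZero 𝕜] {n : ℕ} (v : Fin n → ℕ) :
    (of fun i j : Fin n => ((v i).choose j : 𝕜)).det =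
      ∏ i : Fin n, ∏ j ∈ Ioi i,
        ((v j : 𝕜) - (v i : 𝕜)) / (((j : ℕ) : 𝕜) - ((i : ℕ) : 𝕜)) := by
  have h1 := det_vandermonde_natCast_eq_mul_det_choose (R := 𝕜) v
  have h2 := det_vandermonde_natCast_eq_mul_det_choose (R := 𝕜) (fun i : Fin n => (i : ℕ))
  rw [det_choose_self, mul_one] at h2
  have h0 : (∏ j : Fin n, ((j : ℕ)! : 𝕜)) ≠ 0 :=
    prod_ne_zero_iff.2 fun j _ => Nat.cast_ne_zero.2 (Nat.factorial_ne_zero _)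
  simp_rw [prod_div_distrib]
  rw [← det_vandermonde, ← det_vandermonde (fun i : Fin n => ((i : ℕ) : 𝕜)), h1, h2]
  field_simp

/-- The coefficient of order `k` of the Taylor expansion of `(X - r) ^ k * q` at `r`. -/
theorem taylor_coeff_X_sub_C_pow_mul (r : R) (q : R[X]) (k : ℕ) :
    (taylor r ((X - C r) ^ k * q)).coeff k = q.eval r := by
  have h : taylor r ((X - C r) ^ k * q) = X ^ k * taylor r q := by
    rw [taylor_mul, taylor_pow, map_sub, taylor_X, taylor_C, add_sub_cancel_right]
  rw [h, coeff_X_pow_mul', if_pos le_rfl, Nat.sub_self, taylor_coeff_zero]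

theorem taylor_coeff_of_X_sub_C_pow_dvd {r : R} {p : R[X]} {k : ℕ}
    (h : (X - C r) ^ (k + 1) ∣ p) : (taylor r p).coeff k = 0 := by
  obtain ⟨q, rfl⟩ := h
  rw [taylor_mul, taylor_pow, map_sub, taylor_X, taylor_C, add_sub_cancel_right,
    coeff_X_pow_mul', if_neg (by omega)]

/-- The Newton basis for Hermite interpolation at nodes `x 0, x 1, …`, each of multiplicity `L`. -/
noncomputable def newtonPoly (x : ℕ → R) (L i : ℕ) : R[X] :=
  (X - C (x (i / L))) ^ (i % L) * ∏ l ∈ range (i / L), (X - C (x l)) ^ L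

theorem newtonPoly_monic (x : ℕ → R) (L i : ℕ) : (newtonPoly x L i).Monic :=
  ((monic_X_sub_C _).pow _).mul (monic_prod_of_monic _ _ fun _ _ => (monic_X_sub_C _).pow _)

theorem newtonPoly_natDegree [Nontrivial R] (x : ℕ → R) (L i : ℕ) :
    (newtonPoly x L i).natDegree = i := by
  rw [newtonPoly, ((monic_X_sub_C _).pow _).natDegree_mul
    (monic_prod_of_monic _ _ fun _ _ => (monic_X_sub_C _).pow _),
    natDegree_prod_of_monic _ _ fun _ _ => (monic_X_sub_C _).pow _]
  simp only [(monic_X_sub_C _).natDegree_pow, natDegree_X_sub_C, mul_one, sum_const, card_range,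
    smul_eq_mul]
  rw [mul_comm]
  exact Nat.mod_add_div i L

theorem newtonPoly_dvd (x : ℕ → R) {L i j : ℕ} (hL : 0 < L) (hij : i < j) :
    (X - C (x (i / L))) ^ (i % L + 1) ∣ newtonPoly x L j := by
  rcases (Nat.div_le_div_right (c := L) hij.le).lt_or_eq with h | h
  · refine Dvd.dvd.mul_left ?_ _
    exact (pow_dvd_pow _ (Nat.mod_lt _ hL)).trans
      (dvd_prod_of_mem (fun l => (X - C (x l)) ^ L) (mem_range.2 h))
  · refine Dvd.dvd.mul_right ?_ _
    rw [h]
    refine pow_dvd_pow _ ?_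
    have h1 := Nat.mod_add_div i L
    have h2 := Nat.mod_add_div j L
    rw [h] at h1
    omega

theorem prod_fin_mul_eq_prod_prod {A : Type*} [CommMonoid A] (L M : ℕ) (f : ℕ → ℕ → A)
    (hL : 0 < L) :
    ∏ i : Fin (L * M), f (i / L) (i % L) = ∏ m : Fin M, ∏ k : Fin L, f m k := by
  rw [← Fintype.prod_prod_type' (fun (m : Fin M) (k : Fin L) => f m k),
    ← (finProdFinEquiv.trans (finCongr (Nat.mul_comm M L))).prod_comp]
  refine prod_congr rfl fun p _ => ?_
  simp [finProdFinEquiv, Nat.add_mul_div_left _ _ hL, Nat.mod_eq_of_lt p.2.2, Nat.div_eq_of_lt p.2.2]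

/-- The confluent Vandermonde determinant. -/
theorem det_confluentVandermonde (x : ℕ → R) (L M : ℕ) (hL : 0 < L) :
    (of fun i n : Fin (L * M) =>
        ((n : ℕ).choose (i % L) : R) * x (i / L) ^ ((n : ℕ) - i % L)).det =
      ∏ m : Fin M, ∏ l ∈ range m, (x m - x l) ^ L ^ 2 := by
  nontriviality R
  -- The Newton basis has a coefficient matrix of determinant 1. Multiplying by it turns the entries
  -- into Taylor coefficients of Newton polynomials at the nodes, a triangular matrix.
  have hB := det_matrixOfPolynomials (fun i : Fin (L * M) => newtonPoly x L i)
    (fun i => newtonPoly_natDegree x L i) (fun i => newtonPoly_monic x L i)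
  rw [← mul_one (det _), ← hB, ← det_mul]
  have hmul : ∀ i j : Fin (L * M),
      ((of fun i n : Fin (L * M) =>
        ((n : ℕ).choose (i % L) : R) * x (i / L) ^ ((n : ℕ) - i % L)) *
        (of fun i j : Fin (L * M) => (newtonPoly x L j).coeff i)) i j =
      (taylor (x (i / L)) (newtonPoly x L j)).coeff (i % L) := by
    intro i j
    rw [taylor_coeff, hasseDeriv_apply,
      sum_over_range' _ (by simp) (L * M) (by rw [newtonPoly_natDegree]; exact j.2),
      eval_finsetSum, ← Fin.sum_univ_eq_sum_range
        (fun n => eval (x (i / L)) (monomial (n - i % L)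
          ((n.choose (i % L) : R) * (newtonPoly x L j).coeff n))), mul_apply]
    refine sum_congr rfl fun n _ => ?_
    simp only [of_apply, eval_monomial]
    ring
  rw [det_of_isLowerTriangular]
  · have : ∀ i : Fin (L * M), (taylor (x (i / L)) (newtonPoly x L i)).coeff (i % L) =
        ∏ l ∈ range (i / L), (x (i / L) - x l) ^ L := by
      intro i
      rw [newtonPoly, taylor_coeff_X_sub_C_pow_mul, eval_prod]
      simp
    simp only [hmul, this]
    rw [prod_fin_mul_eq_prod_prod L M (fun m _ => ∏ l ∈ range m, (x m - x l) ^ L) hL]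
    refine prod_congr rfl fun m _ => ?_
    simp only [prod_const, card_univ, Fintype.card_fin, ← prod_pow, ← pow_mul, sq]
  · intro i j hij
    rw [hmul]
    exact taylor_coeff_of_X_sub_C_pow_dvd (newtonPoly_dvd x hL hij)

/-- Scaling row `i` by `x^(i % L)` makes the power of `x` independent of the derivative order, so
that it factors out of every minor. -/
theorem det_scaledConfluentVandermonde (x : ℕ → R) (L M : ℕ) (hL : 0 < L) :
    (of fun i n : Fin (L * M) => ((n : ℕ).choose (i % L) : R) * x (i / L) ^ (n : ℕ)).det =
      (∏ m : Fin M, x m ^ (∑ k : Fin L, (k : ℕ))) *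
        ∏ m : Fin M, ∏ l ∈ range m, (x m - x l) ^ L ^ 2 := by
  rw [← det_confluentVandermonde x L M hL]
  have : (∏ m : Fin M, x m ^ (∑ k : Fin L, (k : ℕ))) =
      ∏ i : Fin (L * M), x (i / L) ^ (i % L : ℕ) := by
    rw [prod_fin_mul_eq_prod_prod L M (fun m k => x m ^ k) hL]
    simp only [prod_pow_eq_pow_sum]
  rw [this, ← det_mul_column]
  congr 1
  ext i n
  simp only [of_apply]
  rcases lt_or_ge (n : ℕ) (i % L) with h | h
  · simp [Nat.choose_eq_zero_of_lt h]
  · rw [mul_left_comm, ← pow_add, Nat.add_sub_cancel' h]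

end Determinants

/-! ### The wedge expansion and comparison of coefficients. -/

section Exterior

variable {𝕜 : Type*} [Field 𝕜]

/-- An alternating form in top degree is fixed by its value on the basis, here 1. -/
theorem starTop_ιMulti {N : ℕ} (v : Fin N → Fin N → 𝕜) :
    starTop (ExteriorAlgebra.ιMulti 𝕜 N v) = (of v).det := by
  let f : (Fin N → 𝕜) [⋀^Fin N]→ₗ[𝕜] 𝕜 :=
    ((stdBasis 𝕜 N).ExteriorAlgebra.coord univ).compAlternatingMap (ExteriorAlgebra.ιMulti 𝕜 N)
  have hf : f = f (stdBasis 𝕜 N) • (stdBasis 𝕜 N).det :=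
    f.eq_smul_basis_det (stdBasis 𝕜 N)
  have h1 : f (stdBasis 𝕜 N) = 1 := by
    have hu : (univ : Finset (Fin N)).card = N := card_fin N
    have h := ExteriorAlgebra.basis_apply_ofCard (stdBasis 𝕜 N) hu
    have hid : ((stdBasis 𝕜 N : Fin N → Fin N → 𝕜) ∘
        (Set.powersetCard.ofFinEmbEquiv.symm (Set.powersetCard.ofCard hu))) =
          stdBasis 𝕜 N := by
      set g : Fin N ↪o Fin N :=
        Set.powersetCard.ofFinEmbEquiv.symm (Set.powersetCard.ofCard hu)
      have hg : (g : Fin N → Fin N) = id := by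
        refine (g.strictMono.range_inj strictMono_id).1 ?_
        rw [(Finite.surjective_of_injective g.injective).range_eq, Set.range_id]
      rw [hg, Function.comp_id]
    rw [ExteriorAlgebra.ιMulti_family, hid] at h
    change (stdBasis 𝕜 N).ExteriorAlgebra.repr (ExteriorAlgebra.ιMulti 𝕜 N (stdBasis 𝕜 N)) univ = 1
    rw [← h, Module.Basis.repr_self, Finsupp.single_eq_same]
  change f v = _
  rw [hf, h1, one_smul, Module.Basis.det_apply, ← det_transpose]
  rfl

theorem list_prod_ιMulti {W : Type*} [AddCommGroup W] [Module 𝕜 W] (L M : ℕ) (w : ℕ → ℕ → W)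
    (hL : 0 < L) :
    (List.ofFn fun m : Fin M => ExteriorAlgebra.ιMulti 𝕜 L fun k : Fin L => w m k).prod =
      ExteriorAlgebra.ιMulti 𝕜 (L * M) fun i => w (i / L) (i % L) := by
  simp only [ExteriorAlgebra.ιMulti_apply]
  rw [List.ofFn_mul', List.prod_flatten, List.map_ofFn]
  congr 2
  funext m
  simp only [Function.comp]
  congr 2
  funext k
  simp [Nat.mul_add_div hL, Nat.mod_eq_of_lt k.2, Nat.div_eq_of_lt k.2]

/-- The `L`-vector spanned by the vectors `∑ n, (n choose k) x ^ n e_n`, `k < L`. -/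
theorem ιMulti_choose_mul_pow [CharZero 𝕜] (N L : ℕ) (x : 𝕜) :
    (ExteriorAlgebra.ιMulti 𝕜 L fun (k : Fin L) (n : Fin N) =>
        ((n : ℕ).choose k : 𝕜) * x ^ (n : ℕ)) =
      ∑ t : Set.powersetCard (Fin N) L, (x ^ sigma t * deltaTilde 𝕜 t) •
        ((stdBasis 𝕜 N).exteriorPower L t : ExteriorAlgebra 𝕜 (Fin N → 𝕜)) := by
  rw [← exteriorPower.ιMulti_apply_coe, ← ((stdBasis 𝕜 N).exteriorPower L).sum_repr
    (exteriorPower.ιMulti 𝕜 L _), Submodule.coe_sum]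
  refine sum_congr rfl fun t _ => ?_
  rw [Submodule.coe_smul]
  congr 1
  rw [exteriorPower.basis_repr_apply, exteriorPower.ιMultiDual_apply_ιMulti, deltaTilde,
    ← det_choose_eq_prod_div, sigma, ← prod_pow_eq_pow_sum, ← det_mul_column, ← det_transpose]
  congr 1
  ext i j
  simp [elt, mul_comm]

theorem list_prod_ofFn_sum {A ι : Type*} [Semiring A] (M : ℕ) (s : Finset ι)
    (f : Fin M → ι → A) :
    (List.ofFn fun m => ∑ t ∈ s, f m t).prod =
      ∑ T ∈ Fintype.piFinset fun _ : Fin M => s, (List.ofFn fun m => f m (T m)).prod := by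
  classical
  induction M with
  | zero => simp
  | succ M ih =>
    rw [List.ofFn_succ, List.prod_cons, ih, sum_mul_sum, ← sum_product']
    refine sum_nbij' (fun p => Fin.cons p.1 p.2) (fun T => (T 0, Fin.tail T)) ?_ ?_ ?_ ?_ ?_
    · rintro ⟨a, b⟩ h
      simp only [mem_product, Fintype.mem_piFinset] at h ⊢
      intro m
      refine Fin.cases ?_ (fun m => ?_) m
      · simpa using h.1
      · simpa using h.2 m
    · intro T h
      simp only [mem_product, Fintype.mem_piFinset] at h ⊢
      exact ⟨h 0, fun m => h m.succ⟩
    · rintro ⟨a, b⟩ _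
      simp
    · intro T _
      simp
    · rintro ⟨a, b⟩ _
      simp [List.ofFn_succ]

theorem list_prod_ofFn_smul {A : Type*} [Ring A] [Algebra 𝕜 A] (M : ℕ) (c : Fin M → 𝕜)
    (a : Fin M → A) :
    (List.ofFn fun m => c m • a m).prod = (∏ m, c m) • (List.ofFn a).prod := by
  induction M with
  | zero => simp
  | succ M ih =>
    rw [List.ofFn_succ, List.prod_cons, ih, List.ofFn_succ, List.prod_cons, Fin.prod_univ_succ,
      smul_mul_smul_comm]

theorem starTop_sum {N : ℕ} {ι : Type*} (s : Finset ι)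
    (f : ι → ExteriorAlgebra 𝕜 (Fin N → 𝕜)) :
    starTop (∑ i ∈ s, f i) = ∑ i ∈ s, starTop (f i) :=
  map_sum ((stdBasis 𝕜 N).ExteriorAlgebra.coord univ) f s

theorem starTop_smul {N : ℕ} (c : 𝕜) (α : ExteriorAlgebra 𝕜 (Fin N → 𝕜)) :
    starTop (c • α) = c * starTop α :=
  map_smul ((stdBasis 𝕜 N).ExteriorAlgebra.coord univ) c α

/-- The coefficient of `e_0 ∧ ⋯ ∧ e_{N-1}` in `e_{T 0} ∧ ⋯ ∧ e_{T (M-1)}`. -/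
noncomputable def wedgeSign (𝕜 : Type*) [Field 𝕜] {N L M : ℕ} (T : Fin M → Set.powersetCard (Fin N) L) : 𝕜 :=
  starTop (List.ofFn fun m =>
    ((stdBasis 𝕜 N).exteriorPower L (T m) : ExteriorAlgebra 𝕜 (Fin N → 𝕜))).prod

/-- The same wedge is computed twice: multilinearly in the basis, and as one determinant. -/
theorem sum_prod_pow_sigma_mul_wedgeSign [CharZero 𝕜] (L M : ℕ) (hL : 0 < L) (x : ℕ → 𝕜) :
    ∑ T : Fin M → Set.powersetCard (Fin (L * M)) L,
        (∏ m : Fin M, x m ^ sigma (T m)) * ((∏ m, deltaTilde 𝕜 (T m)) * wedgeSign 𝕜 T) =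
      (∏ m : Fin M, x m ^ (∑ k : Fin L, (k : ℕ))) *
        ∏ m : Fin M, ∏ l ∈ range m, (x m - x l) ^ L ^ 2 := by
  rw [← det_scaledConfluentVandermonde x L M hL]
  have h := starTop_ιMulti fun i n : Fin (L * M) =>
    ((n : ℕ).choose (i % L) : 𝕜) * x (i / L) ^ (n : ℕ)
  rw [← h, ← list_prod_ιMulti L M (fun m k (n : Fin (L * M)) =>
    ((n : ℕ).choose k : 𝕜) * x m ^ (n : ℕ)) hL]
  simp only [ιMulti_choose_mul_pow]
  rw [list_prod_ofFn_sum, starTop_sum, Fintype.piFinset_univ]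
  refine sum_congr rfl fun T _ => ?_
  rw [list_prod_ofFn_smul, starTop_smul, prod_mul_distrib, mul_assoc, wedgeSign]

/-- The polynomial `∏_{m < n} (X_n - X_m) ^ β`. -/
noncomputable def vandermondePow (𝕜 : Type*) [CommRing 𝕜] (M β : ℕ) : MvPolynomial (Fin M) 𝕜 :=
  ∏ m : Fin M, ∏ n ∈ Ioi m, (MvPolynomial.X n - MvPolynomial.X m) ^ β

theorem prod_prod_range_eq_prod_prod_Ioi {A : Type*} [CommMonoid A] (M : ℕ) (f : ℕ → ℕ → A) :
    ∏ m : Fin M, ∏ l ∈ range m, f m l = ∏ m : Fin M, ∏ n ∈ Ioi m, f n m := by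
  have : ∀ m : Fin M, ∏ l ∈ range m, f m l = ∏ l ∈ Iio m, f (m : ℕ) (l : ℕ) := by
    intro m
    refine (prod_nbij (fun l : Fin M => (l : ℕ)) ?_ ?_ ?_ ?_).symm
    · intro a ha
      simpa using ha
    · exact fun a _ b _ h => Fin.ext h
    · intro a ha
      have ha' : a < m := by simpa using ha
      exact ⟨⟨a, ha'.trans m.2⟩, by simpa [Fin.lt_def] using ha', rfl⟩
    · intros; rfl
  simp only [this]
  exact prod_comm' (by simp)

/-- The field is infinite, so the identity at all points is an identity of polynomials. -/
theorem sum_monomial_eq [CharZero 𝕜] (L M : ℕ) (hL : 0 < L) :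
    ∑ T : Fin M → Set.powersetCard (Fin (L * M)) L,
        MvPolynomial.monomial (Finsupp.equivFunOnFinite.symm fun m => sigma (T m))
          ((∏ m, deltaTilde 𝕜 (T m)) * wedgeSign 𝕜 T) =
      MvPolynomial.monomial (Finsupp.equivFunOnFinite.symm fun _ => ∑ k : Fin L, (k : ℕ)) 1 *
        vandermondePow 𝕜 M (L ^ 2) := by
  refine MvPolynomial.funext fun y => ?_
  have h := sum_prod_pow_sigma_mul_wedgeSign L M hL
    (fun n => if h : n < M then y ⟨n, h⟩ else 0)
  rw [prod_prod_range_eq_prod_prod_Ioi M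
    (fun a b => ((if h : a < M then y ⟨a, h⟩ else 0) - if h : b < M then y ⟨b, h⟩ else 0) ^ L ^ 2)]
    at h
  simp only [Fin.is_lt, dif_pos, Fin.eta] at h
  rw [map_sum, map_mul, MvPolynomial.eval_monomial, one_mul, vandermondePow, map_prod,
    Finsupp.prod_fintype _ _ (by simp)]
  simp only [map_prod, map_pow, map_sub, MvPolynomial.eval_X, MvPolynomial.eval_monomial]
  refine Eq.trans (sum_congr rfl fun T _ => ?_) h
  rw [Finsupp.prod_fintype _ _ (by simp), mul_comm]
  rfl

/-- The balanced exponent `L^2 / 2 * (M - 1)`, shifted by the monomial prefactor, is exactly `Σ̄`;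
`L` even makes the division exact. -/
theorem sigmaBar_eq (L M : ℕ) (hM : 0 < M) (hL : Even L) :
    sigmaBar (L * M) L = ((∑ k : Fin L, (k : ℕ)) + L ^ 2 / 2 * (M - 1) : ℕ) := by
  obtain ⟨r, rfl⟩ := hL
  obtain ⟨M, rfl⟩ := Nat.exists_eq_succ_of_ne_zero hM.ne'
  have h1 : (r + r) ^ 2 / 2 = 2 * r ^ 2 := by
    rw [show (r + r) ^ 2 = 2 * r ^ 2 * 2 by ring, Nat.mul_div_cancel _ two_pos]
  have h2 : ∑ k : Fin (r + r), (k : ℕ) = r * (r + r - 1) := by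
    have := Finset.sum_range_id_mul_two (r + r)
    rw [Fin.sum_univ_eq_sum_range (fun k => k)]
    nlinarith
  rw [h1, h2, sigmaBar]
  rcases Nat.eq_zero_or_pos r with rfl | hr
  · simp
  · push_cast [Nat.cast_sub (show 1 ≤ r + r by omega), Nat.succ_eq_add_one, Nat.add_sub_cancel]
    ring

/-- The hyperpfaffian of the circular ensemble is `1 / M!` times the central coefficient of
`∏_{m < n} (X_n - X_m) ^ (L ^ 2)`. -/
theorem PF_circularGram [CharZero 𝕜] (L M : ℕ) (hL : 0 < L) (hM : 0 < M) (hLe : Even L) :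
    PF (circularGram 𝕜 L M) = (M ! : 𝕜)⁻¹ * (vandermondePow 𝕜 M (L ^ 2)).coeff
      (Finsupp.equivFunOnFinite.symm fun _ => L ^ 2 / 2 * (M - 1)) := by
  classical
  set S : ℕ := (∑ k : Fin L, (k : ℕ)) + L ^ 2 / 2 * (M - 1) with hS
  have hc := congrArg (MvPolynomial.coeff (Finsupp.equivFunOnFinite.symm fun _ : Fin M => S))
    (sum_monomial_eq (𝕜 := 𝕜) L M hL)
  have hadd : (Finsupp.equivFunOnFinite.symm fun _ : Fin M => S) =
      (Finsupp.equivFunOnFinite.symm fun _ : Fin M => ∑ k : Fin L, (k : ℕ)) +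
        Finsupp.equivFunOnFinite.symm fun _ => L ^ 2 / 2 * (M - 1) := by
    ext; simp [hS]
  nth_rewrite 2 [hadd] at hc
  rw [MvPolynomial.coeff_monomial_mul, one_mul, MvPolynomial.coeff_sum] at hc
  rw [← hc, PF, starTop_smul, circularGram]
  congr 1
  simp only [sigmaBar_eq L M hM hLe, ← hS, Nat.cast_inj]
  rw [Submodule.coe_sum, ← List.prod_replicate, ← List.ofFn_const, list_prod_ofFn_sum, starTop_sum]
  simp only [MvPolynomial.coeff_monomial, Finsupp.equivFunOnFinite.symm.injective.eq_iff]
  rw [← sum_filter]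
  refine sum_congr ?_ fun T _ => ?_
  · ext T
    simp [funext_iff]
  · simp only [Submodule.coe_smul]
    rw [list_prod_ofFn_smul, starTop_smul, wedgeSign]

end Exterior

end Hyperpfaffian

namespace Hyperpfaffian

/-! ### Dyson's constant term identity, after Good. -/

section Dyson

open Finset MvPolynomial

variable {σ : Type*} [DecidableEq σ] {𝕜 : Type*} [Field 𝕜]

/-- The product `∏_{i ≠ j} (X_j - X_i) ^ a_i` over `i, j ∈ s`. -/
noncomputable def dysonPoly (𝕜 : Type*) [Field 𝕜] (s : Finset σ) (a : σ → ℕ) :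
    MvPolynomial σ 𝕜 :=
  ∏ i ∈ s, ∏ j ∈ s.erase i, (X j - X i) ^ a i

/-- The exponent `∏_j X_j ^ (|a| - a_j)` of the constant term, the entries being indexed by `s`. -/
noncomputable def dysonExponent (s : Finset σ) (a : σ → ℕ) : σ →₀ ℕ :=
  Finsupp.onFinset s (fun j => if j ∈ s then (∑ i ∈ s, a i) - a j else 0) (by
    intro j hj
    by_contra h
    simp [h] at hj)

/-- Lagrange interpolation of the constant 1, evaluated at 0. -/
theorem sum_prod_div_sub_eq_one {K : Type*} [Field K] {s : Finset σ} (hs : s.Nonempty)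
    (v : σ → K) (hv : Set.InjOn v s) :
    ∑ j ∈ s, ∏ i ∈ s.erase j, v i / (v i - v j) = 1 := by
  have h := congrArg (Polynomial.eval 0) (Lagrange.sum_basis hv hs)
  rw [Polynomial.eval_finsetSum, Polynomial.eval_one] at h
  rw [← h]
  refine sum_congr rfl fun j _ => ?_
  rw [Lagrange.basis, Polynomial.eval_prod]
  refine prod_congr rfl fun i _ => ?_
  simp only [Lagrange.basisDivisor, Polynomial.eval_mul, Polynomial.eval_C, Polynomial.eval_sub,
    Polynomial.eval_X, zero_sub]
  rw [← neg_sub (v j), div_neg, mul_neg, mul_comm, div_eq_mul_inv]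

/-- Multiply by the Lagrange identity in the fraction field: the denominators of the `j`-th term
cancel one factor `X i - X j` for each `i`, lowering `a j` by one. -/
theorem dysonPoly_eq_sum {s : Finset σ} (hs : s.Nonempty) (a : σ → ℕ) (ha : ∀ i ∈ s, 0 < a i) :
    dysonPoly 𝕜 s a = ∑ j ∈ s, (∏ i ∈ s.erase j, X i) *
      dysonPoly 𝕜 s (Function.update a j (a j - 1)) := by
  let ψ := algebraMap (MvPolynomial σ 𝕜) (FractionRing (MvPolynomial σ 𝕜))
  have hψ : Function.Injective ψ := IsFractionRing.injective _ _
  have hX : Function.Injective fun i : σ => ψ (X i) := hψ.comp (X_injective)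
  refine hψ ?_
  have h1 := sum_prod_div_sub_eq_one hs (fun i => ψ (X i)) hX.injOn
  rw [← mul_one (ψ (dysonPoly 𝕜 s a)), ← h1, mul_sum, map_sum]
  refine sum_congr rfl fun j hj => ?_
  have h2 : dysonPoly 𝕜 s a = (∏ i ∈ s.erase j, (X i - X j)) *
      dysonPoly 𝕜 s (Function.update a j (a j - 1)) := by
    rw [dysonPoly, dysonPoly, ← mul_prod_erase s _ hj, ← mul_prod_erase s _ hj, ← mul_assoc]
    congr 1
    · rw [← prod_mul_distrib]
      refine prod_congr rfl fun i _ => ?_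
      rw [Function.update_self, ← pow_succ', Nat.sub_add_cancel (ha j hj)]
    · refine prod_congr rfl fun i hi => ?_
      rw [Function.update_of_ne (ne_of_mem_erase hi)]
  have h3 : ∏ i ∈ s.erase j, (ψ (X i) - ψ (X j)) ≠ 0 :=
    prod_ne_zero_iff.2 fun i hi => sub_ne_zero.2 (hX.ne (ne_of_mem_erase hi))
  rw [h2, prod_div_distrib]
  simp only [map_mul, map_prod, map_sub]
  field_simp

theorem degreeOf_X_sub_X_mul_le (i j : σ) (p : MvPolynomial σ 𝕜) :
    degreeOf j ((X j - X i) * p) ≤ degreeOf j p + 1 := by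
  have h1 : degreeOf j (X j - X i : MvPolynomial σ 𝕜) ≤ 1 := by
    refine (degreeOf_sub_le _ _ _).trans (max_le ?_ ?_)
    · rw [degreeOf_X]; split <;> simp
    · rw [degreeOf_X]; split <;> simp
  exact (degreeOf_mul_le _ _ _).trans (by omega)

/-- At the top degree in `X j`, only the term taking `X j` from every factor contributes. -/
theorem coeff_X_sub_X_pow_mul {i j : σ} (hij : i ≠ j) (e k : ℕ) (m : σ →₀ ℕ)
    (p : MvPolynomial σ 𝕜) (hp : degreeOf j p ≤ e) (hm : m j = e) :
    degreeOf j ((X j - X i) ^ k * p) ≤ e + k ∧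
      coeff (m + Finsupp.single j k) ((X j - X i) ^ k * p) = coeff m p := by
  induction k with
  | zero => simpa using hp
  | succ k ih =>
    rw [pow_succ', mul_assoc]
    set q := (X j - X i) ^ k * p
    refine ⟨(degreeOf_X_sub_X_mul_le i j q).trans (by omega), ?_⟩
    rw [sub_mul, coeff_sub, Finsupp.single_add, ← add_assoc, add_comm _ (Finsupp.single j 1),
      coeff_X_mul, ih.2, sub_eq_self]
    rw [← notMem_support_iff]
    intro hmem
    have h1 := le_degreeOf_of_mem_support j hmem
    have h2 : degreeOf j (X i * q) ≤ degreeOf j q := by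
      refine (degreeOf_mul_le _ _ _).trans ?_
      rw [degreeOf_X, if_neg hij.symm, zero_add]
    simp only [Finsupp.add_apply, Finsupp.single_eq_same] at h1
    omega

theorem coeff_prod_X_sub_X_pow_mul {j : σ} (s : Finset σ) (hj : j ∉ s) (a : σ → ℕ)
    (m : σ →₀ ℕ) (p : MvPolynomial σ 𝕜) (hp : degreeOf j p ≤ m j) :
    degreeOf j ((∏ i ∈ s, (X j - X i) ^ a i) * p) ≤ m j + ∑ i ∈ s, a i ∧
      coeff (m + Finsupp.single j (∑ i ∈ s, a i)) ((∏ i ∈ s, (X j - X i) ^ a i) * p) =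
        coeff m p := by
  induction s using Finset.induction_on with
  | empty => simpa using hp
  | insert i s hi ih =>
    have hj' : j ∉ s := fun h => hj (mem_insert_of_mem h)
    have hij : i ≠ j := fun h => hj (h ▸ mem_insert_self i s)
    obtain ⟨h1, h2⟩ := ih hj'
    have h := coeff_X_sub_X_pow_mul hij _ (a i) (m + Finsupp.single j (∑ i ∈ s, a i)) _ h1
      (by simp)
    rw [prod_insert hi, sum_insert hi, mul_assoc, add_comm (a i), Finsupp.single_add, ← add_assoc,
      ← add_assoc]
    exact ⟨h.1, h.2.trans h2⟩

theorem degreeOf_dysonPoly_of_notMem {j : σ} {s : Finset σ} (hj : j ∉ s) (a : σ → ℕ) :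
    degreeOf j (dysonPoly 𝕜 s a) = 0 := by
  refine Nat.le_zero.1 ((degreeOf_prod_le _ _ _).trans (Nat.le_zero.2 (sum_eq_zero fun i hi => ?_)))
  refine Nat.le_zero.1 ((degreeOf_prod_le _ _ _).trans (Nat.le_zero.2 (sum_eq_zero fun l hl => ?_)))
  refine Nat.le_zero.1 ((degreeOf_pow_le _ _ _).trans ?_)
  have h1 : j ≠ l := fun h => hj (h ▸ mem_of_mem_erase hl)
  have h2 : j ≠ i := fun h => hj (h ▸ hi)
  have := degreeOf_sub_le j (X l : MvPolynomial σ 𝕜) (X i)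
  rw [degreeOf_X, degreeOf_X, if_neg h1, if_neg h2] at this
  simp [Nat.le_zero.1 this]

theorem dysonPoly_insert {j : σ} {s : Finset σ} (hj : j ∉ s) (a : σ → ℕ) (ha : a j = 0) :
    dysonPoly 𝕜 (insert j s) a = (∏ i ∈ s, (X j - X i) ^ a i) * dysonPoly 𝕜 s a := by
  rw [dysonPoly, prod_insert hj, dysonPoly, ← prod_mul_distrib]
  simp only [ha, pow_zero, prod_const_one, one_mul]
  refine prod_congr rfl fun i hi => ?_
  have hij : j ≠ i := fun h => hj (h ▸ hi)
  rw [erase_insert_of_ne hij, prod_insert (fun h => hj (mem_of_mem_erase h))]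

/-- The generalised Pascal rule, matching Good's recursion. -/
theorem multinomial_eq_sum {s : Finset σ} (hs : s.Nonempty) (a : σ → ℕ) (ha : ∀ i ∈ s, 0 < a i) :
    Nat.multinomial s a = ∑ j ∈ s, Nat.multinomial s (Function.update a j (a j - 1)) := by
  have hpos : 0 < ∏ i ∈ s, (a i)! := prod_pos fun i _ => Nat.factorial_pos _
  refine Nat.eq_of_mul_eq_mul_left hpos ?_
  rw [Nat.multinomial_spec, mul_sum]
  have hsum : ∀ j ∈ s, ∑ i ∈ s, Function.update a j (a j - 1) i = (∑ i ∈ s, a i) - 1 := by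
    intro j hj
    have := ha j hj
    rw [← add_sum_erase s a hj, ← add_sum_erase s _ hj, Function.update_self,
      sum_congr rfl fun i hi => Function.update_of_ne (ne_of_mem_erase hi) _ _]
    omega
  have hprod : ∀ j ∈ s, ∏ i ∈ s, (a i)! =
      a j * ∏ i ∈ s, (Function.update a j (a j - 1) i)! := by
    intro j hj
    rw [← mul_prod_erase s _ hj, ← mul_prod_erase s _ hj, Function.update_self, ← mul_assoc,
      Nat.mul_factorial_pred (ha j hj).ne']
    congr 1
    exact prod_congr rfl fun i hi => by rw [Function.update_of_ne (ne_of_mem_erase hi)]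
  have : ∀ j ∈ s, (∏ i ∈ s, (a i)!) * Nat.multinomial s (Function.update a j (a j - 1)) =
      a j * ((∑ i ∈ s, a i) - 1)! := by
    intro j hj
    rw [hprod j hj, mul_assoc, Nat.multinomial_spec, hsum j hj]
  rw [sum_congr rfl this, ← sum_mul, Nat.mul_factorial_pred]
  exact (sum_pos ha hs).ne'

/-- Dyson's constant term identity. -/
theorem coeff_dysonPoly (n : ℕ) : ∀ (s : Finset σ) (a : σ → ℕ), #s + ∑ i ∈ s, a i = n →
    coeff (dysonExponent s a) (dysonPoly 𝕜 s a) = (Nat.multinomial s a : 𝕜) := by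
  -- The measure drops in both cases: either some `a j` is lowered, or an index with `a j = 0` is
  -- removed from `s`.
  induction n using Nat.strong_induction_on with
  | _ n ih =>
  intro s a hn
  rcases s.eq_empty_or_nonempty with rfl | hs
  · have : dysonExponent (∅ : Finset σ) a = 0 := by ext; simp [dysonExponent]
    simp [this, dysonPoly]
  by_cases ha : ∀ i ∈ s, 0 < a i
  · rw [dysonPoly_eq_sum hs a ha, multinomial_eq_sum hs a ha, coeff_sum, Nat.cast_sum]
    refine sum_congr rfl fun j hj => ?_
    have hj0 := ha j hj
    have hle := single_le_sum (f := a) (fun _ _ => Nat.zero_le _) hj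
    have hsum : ∑ i ∈ s, Function.update a j (a j - 1) i = (∑ i ∈ s, a i) - 1 := by
      rw [← add_sum_erase s a hj, ← add_sum_erase s _ hj, Function.update_self,
        sum_congr rfl fun i hi => Function.update_of_ne (ne_of_mem_erase hi) _ _]
      omega
    rw [← ih _ (by rw [hsum]; omega) s (Function.update a j (a j - 1)) rfl]
    have hmon : (∏ i ∈ s.erase j, X i : MvPolynomial σ 𝕜) =
        monomial (∑ i ∈ s.erase j, Finsupp.single i 1) 1 := by
      rw [monomial_sum_one]
      rfl
    -- Lowering `a j` lowers the total too, so the exponent `|a| - a l` drops by one for `l ≠ j` and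
    -- is unchanged at `j`.
    have hexp : dysonExponent s a = (∑ i ∈ s.erase j, Finsupp.single i 1) +
        dysonExponent s (Function.update a j (a j - 1)) := by
      ext l
      simp only [dysonExponent, Finsupp.onFinset_apply, Finsupp.add_apply, Finsupp.finsetSum_apply,
        Finsupp.single_apply, sum_ite_eq', mem_erase, hsum]
      by_cases hl : l ∈ s
      · have hle' := single_le_sum (f := a) (fun _ _ => Nat.zero_le _) hl
        have hl0 := ha l hl
        by_cases hlj : l = j
        · subst hlj
          simp only [hl, Function.update_self, if_true, ne_eq, not_true_eq_false, false_and, if_false]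
          omega
        · simp only [hl, Function.update_of_ne hlj]
          have := sum_le_sum_of_subset (f := a) (show {l, j} ⊆ s by
            intro x; simp only [mem_insert, mem_singleton]; rintro (rfl | rfl) <;> assumption)
          rw [sum_pair hlj] at this
          simp only [if_true, ne_eq, hlj, not_false_eq_true, and_self]
          omega
      · simp [hl]
    rw [hmon, hexp, coeff_monomial_mul, one_mul]
  · push Not at ha
    obtain ⟨j, hj, hj0⟩ := ha
    have hj0 : a j = 0 := by omega
    obtain ⟨s, hjs, rfl⟩ : ∃ t, j ∉ t ∧ insert j t = s :=
      ⟨s.erase j, notMem_erase j s, insert_erase hj⟩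
    rw [dysonPoly_insert hjs a hj0, Nat.multinomial_insert hjs, hj0, Nat.choose_zero_right, one_mul]
    rw [card_insert_of_notMem hjs, sum_insert hjs] at hn
    rw [← ih (#s + ∑ i ∈ s, a i) (by omega) s a rfl]
    have hexp : dysonExponent (insert j s) a =
        dysonExponent s a + Finsupp.single j (∑ i ∈ s, a i) := by
      ext l
      simp only [dysonExponent, Finsupp.onFinset_apply, Finsupp.add_apply, sum_insert hjs, hj0,
        zero_add]
      by_cases hl : l = j
      · subst hl; simp [hjs, hj0]
      · simp [hl]
    rw [hexp]
    exact (coeff_prod_X_sub_X_pow_mul s hjs a _ _ (by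
      rw [degreeOf_dysonPoly_of_notMem hjs]; exact Nat.zero_le _)).2

theorem vandermondePow_eq_dysonPoly (M k : ℕ) (hk : Even k) :
    vandermondePow 𝕜 M (2 * k) = dysonPoly 𝕜 univ fun _ : Fin M => k := by
  rw [vandermondePow, dysonPoly]
  simp only [← compl_singleton]
  rw [← prod_prod_Ioi_mul_eq_prod_prod_off_diag
    (fun j i : Fin M => (X j - X i : MvPolynomial (Fin M) 𝕜) ^ k)]
  refine prod_congr rfl fun m _ => prod_congr rfl fun n _ => ?_
  rw [← hk.neg_pow (X m - X n), neg_sub, ← pow_add, two_mul]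

theorem coeff_vandermondePow (M k : ℕ) (hk : Even k) :
    (vandermondePow 𝕜 M (2 * k)).coeff (Finsupp.equivFunOnFinite.symm fun _ => k * (M - 1)) =
      (Nat.multinomial univ (fun _ : Fin M => k) : 𝕜) := by
  rw [vandermondePow_eq_dysonPoly M k hk, ← coeff_dysonPoly _ univ _ rfl]
  congr 1
  ext i
  simp [dysonExponent, Nat.mul_sub, mul_comm]

end Dyson

end Hyperpfaffian

namespace Hyperpfaffian

/-! ### Integration over the torus. -/

section Circle

open Finset

instance : circleHaar.IsHaarMeasure :=
  inferInstanceAs (Measure.haarMeasure _).IsHaarMeasure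

/-- For `k ≠ 0`, translation by `exp(iπ/k)` negates the integrand but preserves Haar measure. -/
theorem integral_circle_zpow (k : ℤ) :
    ∫ z : Circle, (z : ℂ) ^ k ∂circleHaar = if k = 0 then 1 else 0 := by
  split_ifs with hk
  · simp [hk]
  · set g : Circle := Circle.exp (Real.pi / k)
    have hg : (g : ℂ) ^ k = -1 := by
      rw [← Circle.coe_zpow, ← Circle.exp_intCast_mul,
        mul_div_cancel₀ _ (Int.cast_ne_zero.2 hk), Circle.coe_exp, Complex.exp_pi_mul_I]
    have h := integral_mul_left_eq_self (μ := circleHaar) (fun z : Circle => (z : ℂ) ^ k) g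
    simp only [Circle.coe_mul, mul_zpow, hg, neg_one_mul, integral_neg] at h
    exact self_eq_neg.1 h.symm

theorem integral_torus_prod_zpow {M : ℕ} (k : Fin M → ℤ) :
    ∫ x : Fin M → Circle, ∏ m, (x m : ℂ) ^ k m ∂(Measure.pi fun _ => circleHaar) =
      if k = 0 then 1 else 0 := by
  rw [integral_fintype_prod_eq_prod (fun m (z : Circle) => (z : ℂ) ^ k m)]
  simp only [integral_circle_zpow]
  rw [prod_ite_zero]
  simp [funext_iff]

theorem integrable_torus_prod_zpow {M : ℕ} (k : Fin M → ℤ) :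
    Integrable (fun x : Fin M → Circle => ∏ m, (x m : ℂ) ^ k m)
      (Measure.pi fun _ => circleHaar) :=
  Integrable.fintype_prod (f := fun m (z : Circle) => (z : ℂ) ^ k m) fun m => by
    have hc : Continuous fun z : Circle => (z : ℂ) ^ k m :=
      (show Continuous fun z : Circle => (z : ℂ) by fun_prop).zpow₀ _ fun z => .inl (Circle.coe_ne_zero z)
    exact hc.integrable_of_hasCompactSupport (HasCompactSupport.of_compactSpace _)

/-- The constant term of a Laurent polynomial is its mean over the torus. -/
theorem integral_torus_eval_mul_prod_zpow {M : ℕ} (p : MvPolynomial (Fin M) ℂ) (c : ℕ) :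
    ∫ x : Fin M → Circle, MvPolynomial.eval (fun m => (x m : ℂ)) p * ∏ m, (x m : ℂ) ^ (-c : ℤ)
        ∂(Measure.pi fun _ => circleHaar) =
      p.coeff (Finsupp.equivFunOnFinite.symm fun _ => c) := by
  have h : ∀ x : Fin M → Circle,
      MvPolynomial.eval (fun m => (x m : ℂ)) p * ∏ m, (x m : ℂ) ^ (-c : ℤ) =
        ∑ d ∈ p.support, p.coeff d * ∏ m, (x m : ℂ) ^ ((d m : ℤ) - c) := by
    intro x
    rw [MvPolynomial.eval_eq', sum_mul]
    refine sum_congr rfl fun d _ => ?_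
    rw [mul_assoc, ← prod_mul_distrib]
    congr 1
    refine prod_congr rfl fun m _ => ?_
    rw [sub_eq_add_neg, zpow_add₀ (Circle.coe_ne_zero _), zpow_natCast]
  simp only [h]
  rw [integral_finsetSum _ fun d _ => (integrable_torus_prod_zpow _).const_mul _]
  simp only [integral_const_mul, integral_torus_prod_zpow]
  rw [sum_eq_single (Finsupp.equivFunOnFinite.symm fun _ => c)]
  · rw [if_pos (by ext; simp), mul_one]
  · intro d _ hd
    rw [if_neg, mul_zero]
    intro h0
    refine hd ?_
    ext m
    have := congrFun h0 m
    simp only [Pi.zero_apply] at this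
    simp only [Finsupp.equivFunOnFinite_symm_apply_apply]
    omega
  · intro hc
    rw [MvPolynomial.notMem_support_iff.1 hc, zero_mul]

/-- Conjugation inverts on the circle, so `|z - w|^2 = -(z - w)^2 / (z w)`; `k` even removes the
sign. -/
theorem norm_sub_pow_circle (z w : Circle) {k : ℕ} (hk : Even k) :
    (((‖(z : ℂ) - w‖ ^ (2 * k) : ℝ)) : ℂ) =
      ((z : ℂ) - w) ^ (2 * k) * ((z : ℂ) ^ (-k : ℤ) * (w : ℂ) ^ (-k : ℤ)) := by
  have h : ((‖(z : ℂ) - w‖ ^ 2 : ℝ) : ℂ) = -(((z : ℂ) - w) ^ 2 * ((z : ℂ)⁻¹ * (w : ℂ)⁻¹)) := by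
    rw [Complex.ofReal_pow, ← Complex.mul_conj', map_sub, ← Circle.coe_inv_eq_conj,
      ← Circle.coe_inv_eq_conj, Circle.coe_inv, Circle.coe_inv]
    have hz := Circle.coe_ne_zero z
    have hw := Circle.coe_ne_zero w
    field_simp
    ring
  rw [pow_mul, Complex.ofReal_pow, h, hk.neg_pow, mul_pow, mul_pow, ← pow_mul, zpow_neg, zpow_neg,
    zpow_natCast, zpow_natCast, inv_pow, inv_pow]

theorem prod_norm_sub_pow {M k : ℕ} (hk : Even k) (x : Fin M → Circle) :
    ((∏ m : Fin M, ∏ n ∈ Ioi m, ‖(x n : ℂ) - (x m : ℂ)‖ ^ (2 * k) : ℝ) : ℂ) =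
      MvPolynomial.eval (fun m => (x m : ℂ)) (vandermondePow ℂ M (2 * k)) *
        ∏ m, (x m : ℂ) ^ (-(k * (M - 1) : ℕ) : ℤ) := by
  rw [vandermondePow, map_prod, Complex.ofReal_prod]
  simp only [Complex.ofReal_prod, norm_sub_pow_circle _ _ hk, map_prod, map_pow, map_sub,
    MvPolynomial.eval_X, prod_mul_distrib (f := fun n => ((x n : ℂ) - x _) ^ (2 * k))]
  rw [prod_mul_distrib]
  congr 1
  -- Each variable lies in `M - 1` pairs, and each pair contributes the power `-k`.
  rw [prod_prod_Ioi_mul_eq_prod_prod_off_diag (fun j _ : Fin M => (x j : ℂ) ^ (-k : ℤ)), prod_comm']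
  rotate_left
  · exact fun i j => (by simp [eq_comm] : i ∈ univ ∧ j ∈ ({i}ᶜ : Finset (Fin M)) ↔
      i ∈ ({j}ᶜ : Finset (Fin M)) ∧ j ∈ univ)
  refine prod_congr rfl fun m _ => ?_
  rw [prod_const, card_compl, card_singleton, Fintype.card_fin, ← zpow_natCast, ← zpow_mul]
  congr 1
  push_cast
  ring

theorem circularPartitionFunction_eq {M k : ℕ} (hk : Even k) :
    (circularPartitionFunction (2 * k) M : ℂ) =
      (M ! : ℂ)⁻¹ * (vandermondePow ℂ M (2 * k)).coeff
        (Finsupp.equivFunOnFinite.symm fun _ => k * (M - 1)) := by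
  rw [← integral_torus_eval_mul_prod_zpow, circularPartitionFunction, Complex.ofReal_mul,
    Complex.ofReal_inv, Complex.ofReal_natCast]
  congr 1
  exact integral_ofReal.symm.trans (integral_congr_ae (.of_forall fun x => prod_norm_sub_pow hk x))

end Circle

end Hyperpfaffian

theorem mainTheorem4 {𝕜 : Type*} [Field 𝕜] [CharZero 𝕜] (L M β : ℕ)
    (hL : 0 < L) (hLeven : Even L) (hM : 0 < M) (hβ : β = L ^ 2) :
    Hyperpfaffian.PF (Hyperpfaffian.circularGram 𝕜 L M) =
        (M ! : 𝕜)⁻¹ * (Nat.multinomial Finset.univ (fun _ : Fin M => β / 2) : 𝕜) ∧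
      (Hyperpfaffian.circularPartitionFunction β M : ℂ) =
        Hyperpfaffian.PF (Hyperpfaffian.circularGram ℂ L M) := by
  obtain ⟨r, hr⟩ := hLeven
  -- With `L = 2r`, `β / 2 = 2 r^2` is itself even, so no sign appears in Dyson's product or on the
  -- circle.
  have hsq : L ^ 2 = 2 * (2 * r ^ 2) := by rw [hr]; ring
  have hhalf : L ^ 2 / 2 = 2 * r ^ 2 := by rw [hsq, Nat.mul_div_cancel_left _ two_pos]
  have hk : Even (2 * r ^ 2) := even_two_mul _
  rw [Hyperpfaffian.PF_circularGram L M hL hM ⟨r, hr⟩,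
    Hyperpfaffian.PF_circularGram L M hL hM ⟨r, hr⟩, hβ, hhalf, hsq]
  exact ⟨by rw [Hyperpfaffian.coeff_vandermondePow M _ hk],
    Hyperpfaffian.circularPartitionFunction_eq hk⟩
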